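/- Let $k$ be an algebraically closed field, let $G$ be an affine algebraic group over $k$ with algebra of regular functions $k[G]$, and let $R$ be an associative $k$-algebra with $1$ on which $G$ acts by $k$-algebra automorphisms. Assume that the action is rational: every $G$-orbit in $R$ spans a finite-dimensional subspace, and for each finite-dimensional $G$-stable subspace $V \subseteq R$ the map $G \to \mathrm{GL}(V)$ is a homomorphism of algebraic groups. Ideals are two-sided. An ideal $Q$ is prime if $Q \ne R$ and $AB \subseteq Q$, for ideals $A,B$ of $R$, implies $A \subseteq Q$ or $B \subseteq Q$. A $G$-stable ideal $I \neq R$ is $G$-prime if $AB \subseteq I$, for $G$-stable ideals $A,B$ of $R$, implies $A \subseteq I$ or $B \subseteq I$. For an ideal $Q$, put $G_Q = \{g \in G : g.Q = Q\}$ and $(Q:G) = \bigcap_{g \in G} g.Q$. The extended centroid $\mathcal{C}(S)$ of a ring $S$ is the center of its right Amitsur-Martindale ring of quotients $\mathrm{Q}_r(S) = \varinjlim_J \mathrm{Hom}(J_S, S_S)$, where $J$ runs over the ideals of $S$ with zero left annihilator. The action of $G_Q$ on $R/Q$ extends to $\mathrm{Q}_r(R/Q)$: if $g \in G_Q$ and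 $q$ is the class of $f \colon J \to R/Q$, then $g.q$ is the class of $g.J \to R/Q$, $g.x \mapsto g.f(x)$. For a subgroup $H \le G_Q$, $\mathcal{C}(R/Q)^{H}$ denotes the algebra of $H$-invariants in $\mathcal{C}(R/Q)$. Let $I$ be a $G$-prime ideal of $R$. Then there is a prime ideal $Q$ of $R$ with $[G:G_Q] < \infty$ and $I = (Q:G)$. Moreover, for every prime ideal $Q$ of $R$ with $[G:G_Q] < \infty$ and $I = (Q:G)$, there is an isomorphism of $k$-algebras $$\mathcal{C}(R/I)^G \cong \mathcal{C}(R/Q)^{G_Q}.$$ -/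

import Mathlib

open scoped Pointwise

/-! ### Two-sided ideals, primes, `G`-primes -/

/-- A two-sided ideal `P` of a (not necessarily commutative) ring is prime if it is proper and
`A B ⊆ P` for two-sided ideals `A`, `B` implies `A ⊆ P` or `B ⊆ P`. -/
structure IsPrimeTwoSided {R : Type*} [Ring R] (P : TwoSidedIdeal R) : Prop where
  ne_top : P ≠ ⊤
  mem_or_mem : ∀ A B : TwoSidedIdeal R, (∀ a ∈ A, ∀ b ∈ B, a * b ∈ P) → A ≤ P ∨ B ≤ P

/-- A two-sided ideal is `G`-stable if `g.I = I` for all `g ∈ G`. -/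
def IsGStable (G : Type*) {R : Type*} [Group G] [Ring R] [MulSemiringAction G R]
    (I : TwoSidedIdeal R) : Prop :=
  ∀ g : G, g • (I : Set R) = I

/-- A proper `G`-stable ideal `I` is `G`-prime if `A B ⊆ I` for `G`-stable ideals `A`, `B`
implies `A ⊆ I` or `B ⊆ I`. -/
structure IsGPrime (G : Type*) {R : Type*} [Group G] [Ring R] [MulSemiringAction G R]
    (I : TwoSidedIdeal R) : Prop where
  ne_top : I ≠ ⊤
  stable : IsGStable G I
  mem_or_mem : ∀ A B : TwoSidedIdeal R, IsGStable G A → IsGStable G B →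
    (∀ a ∈ A, ∀ b ∈ B, a * b ∈ I) → A ≤ I ∨ B ≤ I

/-- The isotropy group `G_X = {g ∈ G | g.X = X}` of an ideal. -/
abbrev isotropyGroup (G : Type*) {R : Type*} [Group G] [Ring R] [MulSemiringAction G R]
    (I : TwoSidedIdeal R) : Subgroup G :=
  MulAction.stabilizer G (I : Set R)

/-- The `G`-core `(X : G) = ⋂_{g ∈ G} g.X` of an ideal, as a subset of the ring. -/
def gCore (G : Type*) {R : Type*} [Group G] [Ring R] [MulSemiringAction G R]
    (I : TwoSidedIdeal R) : Set R :=
  ⋂ g : G, g • (I : Set R)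

/-! ### The right Amitsur-Martindale ring of quotients -/

/-- The two-sided ideals with zero left annihilator. -/
def HasZeroLeftAnn {R : Type*} [Ring R] (I : TwoSidedIdeal R) : Prop :=
  ∀ r : R, (∀ x ∈ I, r * x = 0) → r = 0

theorem HasZeroLeftAnn.top {R : Type*} [Ring R] : HasZeroLeftAnn (⊤ : TwoSidedIdeal R) :=
  fun r h => by simpa using h 1 (TwoSidedIdeal.mem_top R)

/-- The product ideal `I J`. -/
def TwoSidedIdeal.prodIdeal {R : Type*} [Ring R] (I J : TwoSidedIdeal R) : TwoSidedIdeal R :=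
  TwoSidedIdeal.span {z | ∃ x ∈ I, ∃ y ∈ J, z = x * y}

theorem TwoSidedIdeal.prodIdeal_le_left {R : Type*} [Ring R] (I J : TwoSidedIdeal R) :
    I.prodIdeal J ≤ I := by
  refine TwoSidedIdeal.span_le.2 ?_
  rintro _ ⟨x, hx, y, -, rfl⟩
  exact I.mul_mem_right _ _ hx

theorem TwoSidedIdeal.prodIdeal_le_right {R : Type*} [Ring R] (I J : TwoSidedIdeal R) :
    I.prodIdeal J ≤ J := by
  refine TwoSidedIdeal.span_le.2 ?_
  rintro _ ⟨x, -, y, hy, rfl⟩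
  exact J.mul_mem_left _ _ hy

theorem HasZeroLeftAnn.prodIdeal {R : Type*} [Ring R] {I J : TwoSidedIdeal R}
    (hI : HasZeroLeftAnn I) (hJ : HasZeroLeftAnn J) : HasZeroLeftAnn (I.prodIdeal J) :=
  fun r h => hI r fun x hx => hJ _ fun y hy => by
    rw [mul_assoc]
    exact h _ (TwoSidedIdeal.subset_span ⟨x, hx, y, hy, rfl⟩)

theorem HasZeroLeftAnn.mono {R : Type*} [Ring R] {I J : TwoSidedIdeal R}
    (hI : HasZeroLeftAnn I) (h : I ≤ J) : HasZeroLeftAnn J :=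
  fun r hr => hI r fun x hx => hr x (h hx)

theorem HasZeroLeftAnn.inf {R : Type*} [Ring R] {I J : TwoSidedIdeal R}
    (hI : HasZeroLeftAnn I) (hJ : HasZeroLeftAnn J) : HasZeroLeftAnn (I ⊓ J) :=
  (hI.prodIdeal hJ).mono (le_inf (I.prodIdeal_le_left J) (I.prodIdeal_le_right J))

/-- A right `R`-module map `f : I_R → R_R` whose domain `I` is a two-sided ideal with zero left
annihilator. -/
structure PartialRightMap (R : Type*) [Ring R] where
  dom : TwoSidedIdeal R
  zeroAnn : HasZeroLeftAnn dom
  map : dom →ₗ[Rᵐᵒᵖ] R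

namespace PartialRightMap

variable {R : Type*} [Ring R]

theorem map_mul_right (f : PartialRightMap R) {x : R} (hx : x ∈ f.dom) (r : R)
    (hxr : x * r ∈ f.dom) : f.map ⟨x * r, hxr⟩ = f.map ⟨x, hx⟩ * r :=
  f.map.map_smul (MulOpposite.op r) ⟨x, hx⟩

theorem map_add_mk (f : PartialRightMap R) {x y : R} (hx : x ∈ f.dom) (hy : y ∈ f.dom)
    (hxy : x + y ∈ f.dom) : f.map ⟨x + y, hxy⟩ = f.map ⟨x, hx⟩ + f.map ⟨y, hy⟩ :=
  f.map.map_add ⟨x, hx⟩ ⟨y, hy⟩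

/-- Two partial maps are identified if they agree on some ideal with zero left annihilator that is
contained in both domains. -/
def Rel (f f' : PartialRightMap R) : Prop :=
  ∃ J : TwoSidedIdeal R, HasZeroLeftAnn J ∧ ∃ (h : J ≤ f.dom) (h' : J ≤ f'.dom),
    ∀ (x : R) (hx : x ∈ J), f.map ⟨x, h hx⟩ = f'.map ⟨x, h' hx⟩

/-- Equivalent partial maps agree on the whole intersection of their domains. -/
theorem rel_iff (f f' : PartialRightMap R) :
    Rel f f' ↔ ∀ (x : R) (h : x ∈ f.dom) (h' : x ∈ f'.dom), f.map ⟨x, h⟩ = f'.map ⟨x, h'⟩ := by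
  constructor
  · rintro ⟨J, hJ, hf, hf', H⟩ x h h'
    rw [← sub_eq_zero]
    refine hJ _ fun y hy => ?_
    have hxy : x * y ∈ J := J.mul_mem_left _ _ hy
    rw [sub_mul, ← f.map_mul_right h y (hf hxy), ← f'.map_mul_right h' y (hf' hxy), H _ hxy,
      sub_self]
  · intro H
    exact ⟨f.dom ⊓ f'.dom, f.zeroAnn.inf f'.zeroAnn, inf_le_left, inf_le_right,
      fun x hx => H x _ _⟩

instance setoid (R : Type*) [Ring R] : Setoid (PartialRightMap R) where
  r := Rel
  iseqv :=
    { refl := fun f => (rel_iff f f).2 fun _ _ _ => rfl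
      symm := fun {f f'} h => (rel_iff f' f).2 fun x h₁ h₂ => ((rel_iff f f').1 h x h₂ h₁).symm
      trans := by
        rintro f g h ⟨J, hJ, hf, hg, H⟩ ⟨J', hJ', hg', hh, H'⟩
        exact ⟨J ⊓ J', hJ.inf hJ', inf_le_left.trans hf, inf_le_right.trans hh, fun x hx =>
          (H x (inf_le_left (b := J') hx)).trans (H' x (inf_le_right (a := J) hx))⟩ }

/-- The sum `f + f' : I ∩ I' → R`. -/
def add (f f' : PartialRightMap R) : PartialRightMap R where
  dom := f.dom ⊓ f'.dom
  zeroAnn := f.zeroAnn.inf f'.zeroAnn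
  map :=
    { toFun := fun x => f.map ⟨x, ((TwoSidedIdeal.mem_inf R).1 x.2).1⟩ +
        f'.map ⟨x, ((TwoSidedIdeal.mem_inf R).1 x.2).2⟩
      map_add' := fun x y => by
        rw [add_add_add_comm, ← map_add, ← map_add]; rfl
      map_smul' := fun r x => by
        rw [RingHom.id_apply, smul_add, ← map_smul, ← map_smul]; rfl }

/-- The negative `-f : I → R`. -/
def neg (f : PartialRightMap R) : PartialRightMap R where
  dom := f.dom
  zeroAnn := f.zeroAnn
  map := -f.map

theorem map_prodIdeal_mem (f f' : PartialRightMap R) {z : R}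
    (hz : z ∈ f'.dom.prodIdeal f.dom) :
    f'.map ⟨z, TwoSidedIdeal.prodIdeal_le_left _ _ hz⟩ ∈ f.dom := by
  have key : f'.dom.prodIdeal f.dom ≤ TwoSidedIdeal.mk'
      {z : R | ∃ h : z ∈ f'.dom, ∀ r : R, f'.map ⟨r * z, f'.dom.mul_mem_left _ _ h⟩ ∈ f.dom}
      ⟨f'.dom.zero_mem, fun r => by
        have : f'.map ⟨r * 0, f'.dom.mul_mem_left _ _ f'.dom.zero_mem⟩ = 0 := by
          convert f'.map.map_zero using 2
          exact Subtype.ext (mul_zero r)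
        rw [this]; exact f.dom.zero_mem⟩
      (fun {x y} ⟨hx, Hx⟩ ⟨hy, Hy⟩ => ⟨f'.dom.add_mem hx hy, fun r => by
        have := f'.map.map_add ⟨r * x, f'.dom.mul_mem_left _ _ hx⟩
          ⟨r * y, f'.dom.mul_mem_left _ _ hy⟩
        have h2 := f.dom.add_mem (Hx r) (Hy r)
        rw [← this] at h2
        convert h2 using 3
        exact mul_add r x y⟩)
      (fun {x} ⟨hx, Hx⟩ => ⟨f'.dom.neg_mem hx, fun r => by
        have := f'.map.map_neg ⟨r * x, f'.dom.mul_mem_left _ _ hx⟩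
        have h2 := f.dom.neg_mem (Hx r)
        rw [← this] at h2
        convert h2 using 3
        exact mul_neg r x⟩)
      (fun {x y} ⟨hy, Hy⟩ => ⟨f'.dom.mul_mem_left _ _ hy, fun r => by
        convert Hy (r * x) using 3
        exact (mul_assoc r x y).symm⟩)
      (fun {x y} ⟨hx, Hx⟩ => ⟨f'.dom.mul_mem_right _ _ hx, fun r => by
        have h1 := f'.map_mul_right (f'.dom.mul_mem_left r x hx) y
          (f'.dom.mul_mem_right _ _ (f'.dom.mul_mem_left r x hx))
        have h2 := f.dom.mul_mem_right _ y (Hx r)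
        rw [← h1] at h2
        convert h2 using 3
        exact (mul_assoc r x y).symm⟩) := by
    refine TwoSidedIdeal.span_le.2 ?_
    rintro _ ⟨x, hx, y, hy, rfl⟩
    rw [TwoSidedIdeal.coe_mk']
    refine ⟨f'.dom.mul_mem_right _ _ hx, fun r => ?_⟩
    have h1 := f'.map_mul_right (f'.dom.mul_mem_left r x hx) y
      (f'.dom.mul_mem_right _ _ (f'.dom.mul_mem_left r x hx))
    have h2 := f.dom.mul_mem_left (f'.map ⟨r * x, f'.dom.mul_mem_left r x hx⟩) y hy
    rw [← h1] at h2
    convert h2 using 3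
    exact (mul_assoc r x y).symm
  have h := key hz
  rw [TwoSidedIdeal.mem_mk'] at h
  obtain ⟨h, H⟩ := h
  convert H 1 using 3
  exact (one_mul z).symm

/-- The composite `f ∘ f' : I' I → R`. -/
def comp (f f' : PartialRightMap R) : PartialRightMap R where
  dom := f'.dom.prodIdeal f.dom
  zeroAnn := f'.zeroAnn.prodIdeal f.zeroAnn
  map :=
    { toFun := fun x => f.map ⟨f'.map ⟨x, TwoSidedIdeal.prodIdeal_le_left _ _ x.2⟩,
        f.map_prodIdeal_mem f' x.2⟩
      map_add' := fun x y => by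
        rw [← map_add]
        congr 1
        exact Subtype.ext (f'.map.map_add ⟨x, _⟩ ⟨y, _⟩)
      map_smul' := fun r x => by
        rw [RingHom.id_apply, ← map_smul]
        congr 1
        exact Subtype.ext (f'.map.map_smul r ⟨x, _⟩) }

/-- Left multiplication `λ_r : R → R`, `x ↦ r x`. -/
def leftMul (r : R) : PartialRightMap R where
  dom := ⊤
  zeroAnn := HasZeroLeftAnn.top
  map :=
    { toFun := fun x => r * (x : R)
      map_add' := fun x y => mul_add r (x : R) (y : R)
      map_smul' := fun s x => (mul_assoc r (x : R) s.unop).symm }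

/-- Transport along a ring isomorphism `e : R ≃ S`: the map `e.f : e(I) → S` with
`(e.f)(e(x)) = e(f(x))`. -/
def transport {S : Type*} [Ring S] (e : R ≃+* S) (f : PartialRightMap R) :
    PartialRightMap S where
  dom := f.dom.comap e.symm
  zeroAnn := fun s hs => by
    have : e.symm s = 0 := f.zeroAnn _ fun x hx => by
      have := hs (e x) (by rw [TwoSidedIdeal.mem_comap]; simpa using hx)
      simpa using congrArg e.symm this
    simpa using this
  map :=
    { toFun := fun y => e (f.map ⟨e.symm y, (TwoSidedIdeal.mem_comap e.symm).1 y.2⟩)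
      map_add' := fun x y => by
        rw [← map_add, ← map_add]
        congr 2
        exact Subtype.ext (map_add e.symm (x : S) (y : S))
      map_smul' := fun s y => by
        have h := f.map_mul_right ((TwoSidedIdeal.mem_comap e.symm).1 y.2) (e.symm s.unop)
          (f.dom.mul_mem_right _ _ ((TwoSidedIdeal.mem_comap e.symm).1 y.2))
        have h' := congrArg e h
        rw [map_mul, e.apply_symm_apply] at h'
        rw [RingHom.id_apply]
        refine Eq.trans ?_ h'
        congr 2
        exact Subtype.ext (map_mul e.symm (y : S) s.unop) }

end PartialRightMap

/-- The right Amitsur-Martindale ring of quotients `Q_r(R)`: classes of right `R`-module maps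
`I_R → R_R`, where `I` runs over the two-sided ideals of `R` with zero left annihilator. -/
def MartindaleQuot (R : Type*) [Ring R] : Type _ := Quotient (PartialRightMap.setoid R)

namespace MartindaleQuot

open PartialRightMap

variable {R : Type*} [Ring R]

/-- The class of a partial map. -/
def mk (f : PartialRightMap R) : MartindaleQuot R := Quotient.mk _ f

theorem mk_eq_iff (f f' : PartialRightMap R) : mk f = mk f' ↔
    ∀ (x : R) (h : x ∈ f.dom) (h' : x ∈ f'.dom), f.map ⟨x, h⟩ = f'.map ⟨x, h'⟩ :=
  Quotient.eq.trans (rel_iff f f')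

theorem mk_surjective : Function.Surjective (mk (R := R)) := Quotient.mk_surjective

instance : Zero (MartindaleQuot R) := ⟨mk (leftMul 0)⟩

instance : One (MartindaleQuot R) := ⟨mk (leftMul 1)⟩

instance : Add (MartindaleQuot R) where
  add := Quotient.map₂ PartialRightMap.add fun _ _ hf _ _ hg =>
    (rel_iff _ _).2 fun x h h' => congrArg₂ (· + ·)
      ((rel_iff _ _).1 hf x ((TwoSidedIdeal.mem_inf R).1 h).1 ((TwoSidedIdeal.mem_inf R).1 h').1)
      ((rel_iff _ _).1 hg x ((TwoSidedIdeal.mem_inf R).1 h).2 ((TwoSidedIdeal.mem_inf R).1 h').2)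

instance : Neg (MartindaleQuot R) where
  neg := Quotient.map PartialRightMap.neg fun _ _ hf =>
    (rel_iff _ _).2 fun x h h' => congrArg (- ·) ((rel_iff _ _).1 hf x h h')

instance : Mul (MartindaleQuot R) where
  mul := Quotient.map₂ PartialRightMap.comp fun f f' hf g g' hg =>
    (rel_iff _ _).2 fun x h h' => by
      have h1 := (rel_iff _ _).1 hg x (TwoSidedIdeal.prodIdeal_le_left _ _ h)
        (TwoSidedIdeal.prodIdeal_le_left _ _ h')
      have h2 := f'.map_prodIdeal_mem g' h'
      refine ((rel_iff _ _).1 hf _ (f.map_prodIdeal_mem g h) (h1 ▸ h2)).trans ?_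
      exact congrArg f'.map (Subtype.ext h1)

theorem mk_add (f g : PartialRightMap R) : mk f + mk g = mk (f.add g) := rfl

theorem mk_neg (f : PartialRightMap R) : -mk f = mk f.neg := rfl

theorem mk_mul (f g : PartialRightMap R) : mk f * mk g = mk (f.comp g) := rfl

theorem zero_def : (0 : MartindaleQuot R) = mk (leftMul 0) := rfl

theorem one_def : (1 : MartindaleQuot R) = mk (leftMul 1) := rfl

instance : Ring (MartindaleQuot R) where
  add_assoc := by
    intro a b c
    obtain ⟨f, rfl⟩ := mk_surjective a
    obtain ⟨g, rfl⟩ := mk_surjective b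
    obtain ⟨h, rfl⟩ := mk_surjective c
    exact (mk_eq_iff _ _).2 fun x _ _ => add_assoc _ _ _
  zero_add := by
    intro a
    obtain ⟨f, rfl⟩ := mk_surjective a
    exact (mk_eq_iff _ _).2 fun x _ h => show 0 * x + f.map ⟨x, h⟩ = _ by rw [zero_mul, zero_add]
  add_zero := by
    intro a
    obtain ⟨f, rfl⟩ := mk_surjective a
    exact (mk_eq_iff _ _).2 fun x _ h => show f.map ⟨x, h⟩ + 0 * x = _ by rw [zero_mul, add_zero]
  add_comm := by
    intro a b
    obtain ⟨f, rfl⟩ := mk_surjective a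
    obtain ⟨g, rfl⟩ := mk_surjective b
    exact (mk_eq_iff _ _).2 fun x _ _ => add_comm _ _
  neg_add_cancel := by
    intro a
    obtain ⟨f, rfl⟩ := mk_surjective a
    exact (mk_eq_iff _ _).2 fun x h _ =>
      show -f.map ⟨x, ((TwoSidedIdeal.mem_inf R).1 h).1⟩ + f.map ⟨x, ((TwoSidedIdeal.mem_inf R).1 h).2⟩
        = 0 * x by rw [zero_mul, neg_add_cancel]
  mul_assoc := by
    intro a b c
    obtain ⟨f, rfl⟩ := mk_surjective a
    obtain ⟨g, rfl⟩ := mk_surjective b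
    obtain ⟨h, rfl⟩ := mk_surjective c
    exact (mk_eq_iff _ _).2 fun x _ _ => rfl
  one_mul := by
    intro a
    obtain ⟨f, rfl⟩ := mk_surjective a
    exact (mk_eq_iff _ _).2 fun x _ h => one_mul (f.map ⟨x, h⟩)
  mul_one := by
    intro a
    obtain ⟨f, rfl⟩ := mk_surjective a
    exact (mk_eq_iff _ _).2 fun x _ h => congrArg f.map (Subtype.ext (one_mul x))
  zero_mul := by
    intro a
    obtain ⟨f, rfl⟩ := mk_surjective a
    exact (mk_eq_iff _ _).2 fun x h _ => (zero_mul _).trans (zero_mul x).symm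
  mul_zero := by
    intro a
    obtain ⟨f, rfl⟩ := mk_surjective a
    refine (mk_eq_iff _ _).2 fun x h _ => ?_
    refine Eq.trans ?_ (zero_mul x).symm
    refine Eq.trans (congrArg f.map (Subtype.ext ?_)) f.map.map_zero
    exact zero_mul x
  left_distrib := by
    intro a b c
    obtain ⟨f, rfl⟩ := mk_surjective a
    obtain ⟨g, rfl⟩ := mk_surjective b
    obtain ⟨h, rfl⟩ := mk_surjective c
    exact (mk_eq_iff _ _).2 fun x _ h' => f.map_add_mk
      (f.map_prodIdeal_mem g ((TwoSidedIdeal.mem_inf R).1 h').1)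
      (f.map_prodIdeal_mem h ((TwoSidedIdeal.mem_inf R).1 h').2) _
  right_distrib := by
    intro a b c
    obtain ⟨f, rfl⟩ := mk_surjective a
    obtain ⟨g, rfl⟩ := mk_surjective b
    obtain ⟨h, rfl⟩ := mk_surjective c
    exact (mk_eq_iff _ _).2 fun x _ _ => rfl
  nsmul := nsmulRec
  zsmul := zsmulRec

/-- The canonical ring homomorphism `R → Q_r(R)`, `r ↦ [λ_r]`. -/
def of (R : Type*) [Ring R] : R →+* MartindaleQuot R where
  toFun r := mk (leftMul r)
  map_zero' := rfl
  map_one' := rfl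
  map_add' r s := (mk_eq_iff _ _).2 fun x _ _ => add_mul r s x
  map_mul' r s := (mk_eq_iff _ _).2 fun x _ _ => mul_assoc r s x

/-- If `R` is a `k`-algebra, then so is `Q_r(R)`, via `k → R → Q_r(R)`. -/
instance {k : Type*} [Field k] [Algebra k R] : Algebra k (MartindaleQuot R) :=
  ((of R).comp (algebraMap k R)).toAlgebra' fun c q => by
    obtain ⟨f, rfl⟩ := mk_surjective q
    refine (mk_eq_iff _ _).2 fun x h h' => ?_
    have hx : x ∈ f.dom := TwoSidedIdeal.prodIdeal_le_left _ _ h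
    have hxc : x * algebraMap k R c ∈ f.dom := f.dom.mul_mem_right _ _ hx
    refine (Algebra.commutes c (f.map ⟨x, hx⟩)).trans ?_
    refine (f.map_mul_right hx _ hxc).symm.trans (congrArg f.map (Subtype.ext ?_))
    exact (Algebra.commutes c x).symm

theorem algebraMap_def {k : Type*} [Field k] [Algebra k R] (c : k) :
    algebraMap k (MartindaleQuot R) c = mk (leftMul (algebraMap k R c)) := rfl

/-- The extension of a `k`-algebra isomorphism `e : R ≃ S` to `Q_r(R) → Q_r(S)`; it sends the class
of `f : I → R` to the class of `e.f : e(I) → S`, `e(x) ↦ e(f(x))`. -/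
def extend {k S : Type*} [Field k] [Algebra k R] [Ring S] [Algebra k S] (e : R ≃ₐ[k] S) :
    MartindaleQuot R →ₐ[k] MartindaleQuot S where
  toFun := Quotient.map (PartialRightMap.transport (e : R ≃+* S)) fun f f' hf =>
    (rel_iff _ _).2 fun x h h' => congrArg e ((rel_iff _ _).1 hf _
      ((TwoSidedIdeal.mem_comap _).1 h) ((TwoSidedIdeal.mem_comap _).1 h'))
  map_one' := (mk_eq_iff _ _).2 fun x _ _ =>
    show e (1 * e.symm x) = 1 * x by rw [one_mul, one_mul, e.apply_symm_apply]
  map_mul' a b := by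
    obtain ⟨f, rfl⟩ := mk_surjective a
    obtain ⟨g, rfl⟩ := mk_surjective b
    refine (mk_eq_iff _ _).2 fun x h h' => ?_
    refine congrArg e (congrArg f.map (Subtype.ext ?_))
    exact (e.symm_apply_apply _).symm
  map_zero' := (mk_eq_iff _ _).2 fun x _ _ =>
    show e (0 * e.symm x) = 0 * x by rw [zero_mul, zero_mul, map_zero]
  map_add' a b := by
    obtain ⟨f, rfl⟩ := mk_surjective a
    obtain ⟨g, rfl⟩ := mk_surjective b
    exact (mk_eq_iff _ _).2 fun x _ _ => map_add e _ _
  commutes' c := (mk_eq_iff _ _).2 fun x _ _ =>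
    show e (algebraMap k R c * e.symm x) = algebraMap k S c * x by
      rw [map_mul, e.commutes, e.apply_symm_apply]

end MartindaleQuot

/-- The extended centroid `C(R)`, the center of `Q_r(R)`. -/
def extendedCentroid (k R : Type*) [Field k] [Ring R] [Algebra k R] :
    Subalgebra k (MartindaleQuot R) :=
  Subalgebra.center k (MartindaleQuot R)

/-- The quotient algebra `R / I`. -/
abbrev quotAlg {R : Type*} [Ring R] (I : TwoSidedIdeal R) : Type _ := I.ringCon.Quotient

section Invariants

variable (k : Type*) {G R : Type*} [Field k] [Group G] [Ring R] [Algebra k R]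
  [MulSemiringAction G R] [SMulCommClass G k R]

theorem ringCon_eq_comap_of_mem_isotropyGroup (I : TwoSidedIdeal R) (g : G)
    (hg : g ∈ isotropyGroup G I) :
    I.ringCon = I.ringCon.comap (MulSemiringAction.toAlgEquiv k R g) := by
  have key : ∀ x : R, g • x ∈ I ↔ x ∈ I := fun x => by
    have h : g • (I : Set R) = I := hg
    rw [← SetLike.mem_coe, ← SetLike.mem_coe]
    nth_rewrite 1 [← h]
    exact Set.smul_mem_smul_set_iff
  ext x y
  rw [RingCon.comap_rel, I.rel_iff, I.rel_iff, ← map_sub]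
  exact (key _).symm

/-- The automorphism `r + I ↦ g.r + I` of `R / I` induced by an element `g` of the isotropy group
of `I`. -/
def quotAut (I : TwoSidedIdeal R) (g : G) (hg : g ∈ isotropyGroup G I) :
    quotAlg I ≃ₐ[k] quotAlg I :=
  RingCon.congrₐ k (MulSemiringAction.toAlgEquiv k R g)
    (ringCon_eq_comap_of_mem_isotropyGroup k I g hg)

/-- The algebra `C(R/I)^H` of invariants in the extended centroid of `R/I` under a subgroup `H` of
the isotropy group of `I`. -/
def invExtendedCentroid (I : TwoSidedIdeal R) (H : Subgroup G) (hH : H ≤ isotropyGroup G I) :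
    Subalgebra k (MartindaleQuot (quotAlg I)) where
  carrier := {q | q ∈ extendedCentroid k (quotAlg I) ∧
    ∀ (g : G) (hg : g ∈ H), MartindaleQuot.extend (quotAut k I g (hH hg)) q = q}
  mul_mem' := fun ⟨ha, ha'⟩ ⟨hb, hb'⟩ =>
    ⟨mul_mem ha hb, fun g hg => by rw [map_mul, ha' g hg, hb' g hg]⟩
  add_mem' := fun ⟨ha, ha'⟩ ⟨hb, hb'⟩ =>
    ⟨add_mem ha hb, fun g hg => by rw [map_add, ha' g hg, hb' g hg]⟩
  algebraMap_mem' := fun c => ⟨Subalgebra.algebraMap_mem _ c, fun g hg => AlgHom.commutes _ c⟩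

end Invariants

/-! ### Affine algebraic groups and rational actions -/

/-- The structure of an affine algebraic group over (an algebraically closed field) `k` on a group
`G`, given by its algebra `k[G]` of regular functions. The first two conditions say that `G` is an
affine variety with coordinate ring `k[G]`, i.e. the maximal spectrum of a finitely generated
algebra of functions; the last two say that multiplication `G × G → G` and inversion `G → G` are
morphisms of varieties, where `k[G × G] = k[G] ⊗ k[G]`. -/
structure AffineAlgebraicGroup (k G : Type*) [Field k] [Group G] where
  /-- The algebra `k[G]` of regular functions on `G`. -/
  regular : Subalgebra k (G → k)
  fg : regular.FG
  points : Function.Bijective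
    (fun g : G => (Pi.evalAlgHom k (fun _ : G => k) g).comp regular.val)
  mul_regular : ∀ f ∈ regular, ∃ (n : ℕ) (a b : Fin n → G → k),
    (∀ i, a i ∈ regular) ∧ (∀ i, b i ∈ regular) ∧ ∀ x y : G, f (x * y) = ∑ i, a i x * b i y
  inv_regular : ∀ f ∈ regular, (fun x : G => f x⁻¹) ∈ regular

/-- A linear action of the affine algebraic group `G` on `M` is rational (`M` is a `G`-module) if it
is locally finite and, for each finite-dimensional `G`-stable subspace `V`, the homomorphism
`G → GL(V)` is a morphism of algebraic groups, i.e. all its matrix coefficients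
`g ↦ ℓ(g.v)` with `v ∈ V`, `ℓ ∈ V*` are regular functions on `G` (the inverse of the determinant of
`g` on `V`, being the determinant of `g⁻¹`, is then regular as well). -/
structure AffineAlgebraicGroup.IsRationalAction {k G : Type*} [Field k] [Group G]
    (𝔾 : AffineAlgebraicGroup k G) (M : Type*) [AddCommGroup M] [Module k M]
    [DistribMulAction G M] [SMulCommClass G k M] : Prop where
  locallyFinite : ∀ m : M, FiniteDimensional k (Submodule.span k (Set.range fun g : G => g • m))
  regular_coeff : ∀ V : Submodule k M, FiniteDimensional k V →
    ∀ hV : ∀ (g : G) (v : M), v ∈ V → g • v ∈ V,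
    ∀ (v : V) (l : Module.Dual k V), (fun g : G => l ⟨g • (v : M), hV g v v.2⟩) ∈ 𝔾.regular

/-!
The existence of `Q` combines two arguments. First, an ideal that is maximal among those with
`G`-core contained in `I` is prime with core `I`; Zorn's lemma applies because orbits span
finite-dimensional subspaces (`IsGPrime.exists_isPrimeTwoSided`). Secondly, the Zariski topology
makes `G` a Noetherian space, and the largest irreducible subset containing `1` is a subgroup `H` of
finite index (`exists_finiteIndex_isIrreducible`). The sets `{g | g.a ∈ Q}` are closed, and if
`a R b` lies in the `H`-core of `Q`, then two of them cover the irreducible set `H`. So the `H`-core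
of a prime ideal is prime (`IsPrimeTwoSided.isPrimeTwoSided_coreOn`); it is stable under `H` and has
the same `G`-core as `Q`.

For the isomorphism, elements `q` of a Martindale ring of quotients are handled through their
graphs, the pairs `(x, y)` of ring elements with `q x = y`. The finitely many conjugates of `Q` are
pairwise incomparable primes with intersection `I`, so the intersection `N` of the conjugates other
than `Q` is not contained in `Q`, while `N ∩ Q = I`. Consequently the image of `Q` in `R / I` is the
annihilator of that of `N`, and it is preserved by all partial maps. Reducing graphs modulo `Q` thus
gives a homomorphism `C(R/I) → C(R/Q)` (`IsPrimeFactor.centroidMap`), which restricts to the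
invariants. It is injective on `G`-invariants, since a `G`-invariant map with values in `Q` has
values in every conjugate of `Q`. It is surjective, since an invariant `c` of `C(R/Q)` is the
reduction of the map that sends `x` to `y` when `c (g.x) = g.y` modulo `Q` for all `g ∈ G`
(`exists_centroidMap_eq`).
-/

/-! ### Prime ideals, elementwise -/

/-- The ideals are `A = {x | x R b ⊆ P}` and `B = {y | A y ⊆ P}`. -/
theorem TwoSidedIdeal.exists_mul_le_of_forall_mul {R : Type*} [Ring R] {P : TwoSidedIdeal R}
    {a b : R} (h : ∀ r, a * r * b ∈ P) : ∃ A B : TwoSidedIdeal R, P ≤ A ∧ P ≤ B ∧ a ∈ A ∧ b ∈ B ∧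
      ∀ x ∈ A, ∀ y ∈ B, x * y ∈ P := by
  let A : TwoSidedIdeal R := TwoSidedIdeal.mk' {x | ∀ r, x * r * b ∈ P}
    (fun r => by simp)
    (fun {x y} hx hy r => by simpa [add_mul] using P.add_mem (hx r) (hy r))
    (fun {x} hx r => by simpa using P.neg_mem (hx r))
    (fun {x y} hy r => by simpa [mul_assoc] using P.mul_mem_left x _ (hy r))
    (fun {x y} hx r => by simpa [mul_assoc] using hx (y * r))
  have hA (x : R) : x ∈ A ↔ ∀ r, x * r * b ∈ P := TwoSidedIdeal.mem_mk' ..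
  let B : TwoSidedIdeal R := TwoSidedIdeal.mk' {y | ∀ x ∈ A, x * y ∈ P}
    (fun x _ => by simp)
    (fun {y z} hy hz x hx => by simpa [mul_add] using P.add_mem (hy x hx) (hz x hx))
    (fun {y} hy x hx => by simpa using P.neg_mem (hy x hx))
    (fun {y z} hz x hx => by simpa [mul_assoc] using hz _ (A.mul_mem_right x y hx))
    (fun {y z} hy x hx => by simpa [mul_assoc] using P.mul_mem_right _ z (hy x hx))
  have hB (y : R) : y ∈ B ↔ ∀ x ∈ A, x * y ∈ P := TwoSidedIdeal.mem_mk' ..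
  exact ⟨A, B, fun x hx => (hA x).2 fun r => P.mul_mem_right _ _ (P.mul_mem_right _ _ hx),
    fun y hy => (hB y).2 fun x _ => P.mul_mem_left _ _ hy, (hA a).2 h,
    (hB b).2 fun x hx => by simpa using (hA x).1 hx 1, fun x hx y hy => (hB y).1 hy x hx⟩

theorem IsPrimeTwoSided.mem_or_mem_of_forall_mul {R : Type*} [Ring R] {P : TwoSidedIdeal R}
    (hP : IsPrimeTwoSided P) {a b : R} (h : ∀ r, a * r * b ∈ P) : a ∈ P ∨ b ∈ P := by
  obtain ⟨A, B, -, -, ha, hb, hAB⟩ := TwoSidedIdeal.exists_mul_le_of_forall_mul h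
  exact (hP.mem_or_mem A B hAB).imp (fun hle => hle ha) fun hle => hle hb

theorem isPrimeTwoSided_of_forall_mul {R : Type*} [Ring R] {P : TwoSidedIdeal R} (hP : P ≠ ⊤)
    (h : ∀ a b : R, (∀ r, a * r * b ∈ P) → a ∈ P ∨ b ∈ P) : IsPrimeTwoSided P where
  ne_top := hP
  mem_or_mem A B hAB := by
    by_contra! hne
    obtain ⟨a, ha, haP⟩ := Set.not_subset.1 hne.1
    obtain ⟨b, hb, hbP⟩ := Set.not_subset.1 hne.2
    exact (h a b fun r => hAB _ (A.mul_mem_right _ _ ha) _ hb).elim haP hbP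

/-- A prime ideal that contains a finite intersection of ideals contains one of them. -/
theorem IsPrimeTwoSided.exists_le_of_finset_inf_le {R : Type*} [Ring R] {P : TwoSidedIdeal R}
    (hP : IsPrimeTwoSided P) (s : Finset (TwoSidedIdeal R)) (h : s.inf id ≤ P) :
    ∃ A ∈ s, A ≤ P := by
  classical
  induction s using Finset.induction_on with
  | empty => exact absurd (top_le_iff.1 (by simpa using h)) hP.ne_top
  | insert A s _ ih =>
    rw [Finset.inf_insert, id] at h
    rcases hP.mem_or_mem A (s.inf id) fun a ha b hb => h ((TwoSidedIdeal.mem_inf R).2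
      ⟨A.mul_mem_right _ _ ha, (s.inf id).mul_mem_left _ _ hb⟩) with h1 | h1
    · exact ⟨A, Finset.mem_insert_self .., h1⟩
    · obtain ⟨B, hB, hle⟩ := ih h1
      exact ⟨B, Finset.mem_insert_of_mem hB, hle⟩

/-! ### Calculating in the Martindale ring of quotients -/

namespace MartindaleQuot

variable {S : Type*} [Ring S]

theorem mk_mul_of (f : PartialRightMap S) {x : S} (hx : x ∈ f.dom) :
    mk f * of S x = of S (f.map ⟨x, hx⟩) :=
  (mk_eq_iff _ _).2 fun z _ _ => f.map_mul_right hx z (f.dom.mul_mem_right _ _ hx)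

theorem of_injective : Function.Injective (of S) := fun x y h => by
  have : x * 1 = y * 1 :=
    (mk_eq_iff _ _).1 h 1 (TwoSidedIdeal.mem_top S) (TwoSidedIdeal.mem_top S)
  simpa using this

theorem exists_dom (q : MartindaleQuot S) : ∃ J : TwoSidedIdeal S, HasZeroLeftAnn J ∧
    ∀ x ∈ J, ∃ y, q * of S x = of S y := by
  obtain ⟨f, rfl⟩ := mk_surjective q
  exact ⟨f.dom, f.zeroAnn, fun x hx => ⟨_, mk_mul_of f hx⟩⟩

theorem ext_of_mul_of {D : Set S} (hl : ∀ s, ∀ x ∈ D, s * x ∈ D)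
    (hann : ∀ s, (∀ x ∈ D, s * x = 0) → s = 0) {q q' : MartindaleQuot S}
    (h : ∀ x ∈ D, q * of S x = q' * of S x) : q = q' := by
  rw [← sub_eq_zero]
  replace h : ∀ x ∈ D, (q - q') * of S x = 0 := fun x hx => by rw [sub_mul, h x hx, sub_self]
  generalize q - q' = p at h
  obtain ⟨f, rfl⟩ := mk_surjective p
  refine (mk_eq_iff _ _).2 fun z hz _ => ?_
  refine (hann _ fun x hx => of_injective ?_).trans (zero_mul z).symm
  rw [map_mul, ← mk_mul_of f hz, mul_assoc, ← map_mul, h _ (hl z x hx), map_zero]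

theorem ext_of_mul_of_ideal {J : TwoSidedIdeal S} (hJ : HasZeroLeftAnn J)
    {q q' : MartindaleQuot S} (h : ∀ x ∈ J, q * of S x = q' * of S x) : q = q' :=
  ext_of_mul_of (D := (J : Set S)) (fun s x hx => J.mul_mem_left s x hx) (fun s hs => hJ s hs) h

/-- An additive right-linear relation whose domain is an ideal with zero left annihilator is the
graph of a partial map, so it defines an element of the ring of quotients. -/
theorem exists_of_graph (r : S → S → Prop) (zero : r 0 0) (eq_zero : ∀ y, r 0 y → y = 0)
    (add : ∀ x y x' y', r x y → r x' y' → r (x + x') (y + y'))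
    (mul_right : ∀ x y s, r x y → r (x * s) (y * s))
    (mul_left : ∀ x y s, r x y → ∃ y', r (s * x) y')
    (ann : ∀ s, (∀ x y, r x y → s * x = 0) → s = 0) :
    ∃ q : MartindaleQuot S, ∀ x y, r x y → q * of S x = of S y := by
  have neg : ∀ x y, r x y → r (-x) (-y) := fun x y h => by simpa using mul_right x y (-1) h
  have uniq : ∀ x y y', r x y → r x y' → y = y' := fun x y y' h h' => by
    have := add _ _ _ _ h (neg _ _ h')
    rw [add_neg_cancel] at this
    simpa [← sub_eq_add_neg, sub_eq_zero] using eq_zero _ this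
  let J : TwoSidedIdeal S := TwoSidedIdeal.mk' {x | ∃ y, r x y} ⟨0, zero⟩
    (fun ⟨y, h⟩ ⟨y', h'⟩ => ⟨_, add _ _ _ _ h h'⟩) (fun ⟨y, h⟩ => ⟨_, neg _ _ h⟩)
    (fun ⟨y, h⟩ => mul_left _ y _ h) (fun ⟨y, h⟩ => ⟨_, mul_right _ y _ h⟩)
  have hJ (x : S) : x ∈ J ↔ ∃ y, r x y := TwoSidedIdeal.mem_mk' ..
  choose F hF using fun x : J => (hJ x).1 x.2
  let f : PartialRightMap S :=
    { dom := J
      zeroAnn := fun s hs => ann s fun x y h => hs x ((hJ x).2 ⟨y, h⟩)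
      map :=
        { toFun := F
          map_add' := fun x y => uniq _ _ _ (hF (x + y)) (add _ _ _ _ (hF x) (hF y))
          map_smul' := fun s x => uniq _ _ _ (hF (s • x)) (mul_right _ _ s.unop (hF x)) } }
  exact ⟨mk f, fun x y h => (mk_mul_of f ((hJ x).2 ⟨y, h⟩)).trans
    (congrArg _ (uniq _ _ _ (hF _) h))⟩

/-- An element of the ring of quotients is central as soon as it commutes with the image of `S`,
that is, as soon as the partial maps that represent it are bimodule maps. -/
theorem mem_extendedCentroid_of_commute {k : Type*} [Field k] [Algebra k S]
    {q : MartindaleQuot S} (h : ∀ s, q * of S s = of S s * q) : q ∈ extendedCentroid k S := by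
  refine Subalgebra.mem_center_iff.2 fun p => ?_
  obtain ⟨J, hJ, hJq⟩ := exists_dom q
  obtain ⟨K, hK, hKp⟩ := exists_dom p
  refine ext_of_mul_of_ideal hK fun z hz => ext_of_mul_of_ideal hJ fun x hx => ?_
  obtain ⟨w, hw⟩ := hKp z hz
  calc p * q * of S z * of S x = p * of S z * (q * of S x) := by
        rw [mul_assoc p q, h z]; simp only [mul_assoc]
    _ = q * of S w * of S x := by rw [hw, h w, mul_assoc]
    _ = q * p * of S z * of S x := by rw [← hw]; simp only [mul_assoc]

theorem commute_of_mem_extendedCentroid {k : Type*} [Field k] [Algebra k S]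
    {q : MartindaleQuot S} (h : q ∈ extendedCentroid k S) (p : MartindaleQuot S) :
    q * p = p * q :=
  (Subalgebra.mem_center_iff.1 h p).symm

theorem extend_of {k T : Type*} [Field k] [Algebra k S] [Ring T] [Algebra k T] (e : S ≃ₐ[k] T)
    (s : S) : extend e (of S s) = of T (e s) :=
  (mk_eq_iff _ _).2 fun x _ _ => show e (s * e.symm x) = e s * x by simp

end MartindaleQuot

/-! ### Passing to a prime factor ring -/

section PrimeFactor

open MartindaleQuot

variable {k S T : Type*} [Field k] [Ring S] [Algebra k S] [Ring T] [Algebra k T]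

/-- A surjective homomorphism `φ` onto a prime ring such that some ideal is not killed by `φ` but
meets the kernel of `φ` trivially. For instance, `φ` may be the projection of a ring in which zero
is an irredundant finite intersection of primes onto one of the prime factor rings. -/
structure IsPrimeFactor (φ : S →ₐ[k] T) : Prop where
  surjective : Function.Surjective φ
  prime : ∀ a b : T, (∀ r, a * r * b = 0) → a = 0 ∨ b = 0
  exists_ideal : ∃ N : TwoSidedIdeal S, (∀ n ∈ N, φ n = 0 → n = 0) ∧ ∃ n ∈ N, φ n ≠ 0

namespace IsPrimeFactor

variable {φ : S →ₐ[k] T}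

theorem zero_ann (hφ : IsPrimeFactor φ) {D : Set T} (hl : ∀ s, ∀ x ∈ D, s * x ∈ D)
    {t : T} (ht : t ∈ D) (h0 : t ≠ 0) (s : T) (hs : ∀ x ∈ D, s * x = 0) : s = 0 :=
  (hφ.prime s t fun r => by rw [mul_assoc]; exact hs _ (hl r t ht)).resolve_right h0

theorem exists_apply_ne_zero (hφ : IsPrimeFactor φ) {J : TwoSidedIdeal S}
    (hJ : HasZeroLeftAnn J) : ∃ x ∈ J, φ x ≠ 0 := by
  obtain ⟨N, hN, n, hn, hn0⟩ := hφ.exists_ideal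
  by_contra! h
  refine hn0 ?_
  rw [hJ n fun x hx => hN _ (N.mul_mem_right _ _ hn) (by rw [map_mul, h x hx, mul_zero]), map_zero]

theorem exists_graph_apply_ne_zero (hφ : IsPrimeFactor φ) (q : MartindaleQuot S) :
    ∃ x y, q * of S x = of S y ∧ φ x ≠ 0 := by
  obtain ⟨J, hJ, h⟩ := exists_dom q
  obtain ⟨x, hx, hx0⟩ := hφ.exists_apply_ne_zero hJ
  obtain ⟨y, hy⟩ := h x hx
  exact ⟨x, y, hy, hx0⟩

/-- Partial maps on `S` preserve the kernel of `φ`: it is the annihilator of the ideal `N` that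
complements it. -/
theorem apply_eq_zero_of_graph (hφ : IsPrimeFactor φ) {q : MartindaleQuot S} {x y : S}
    (h : q * of S x = of S y) (hx : φ x = 0) : φ y = 0 := by
  obtain ⟨N, hN, n, hn, hn0⟩ := hφ.exists_ideal
  refine (hφ.prime _ (φ n) fun r => ?_).resolve_right hn0
  obtain ⟨s, rfl⟩ := hφ.surjective r
  have hxn : x * (s * n) = 0 :=
    hN _ (N.mul_mem_left _ _ (N.mul_mem_left _ _ hn)) (by rw [map_mul, hx, zero_mul])
  have : y * (s * n) = 0 := of_injective <| by
    rw [map_mul, ← h, mul_assoc, ← map_mul, hxn, map_zero, mul_zero]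
  rw [mul_assoc, ← map_mul, ← map_mul, this, map_zero]

theorem exists_descent (hφ : IsPrimeFactor φ) {q : MartindaleQuot S}
    (hq : q ∈ extendedCentroid k S) : ∃ c : MartindaleQuot T, ∀ x y, q * of S x = of S y →
      c * of T (φ x) = of T (φ y) := by
  obtain ⟨c, hc⟩ := exists_of_graph
    (fun t u : T => ∃ x y, φ x = t ∧ φ y = u ∧ q * of S x = of S y)
    ⟨0, 0, map_zero _, map_zero _, by simp⟩
    (by rintro _ ⟨x, y, hx, rfl, h⟩; exact hφ.apply_eq_zero_of_graph h hx)
    (by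
      rintro _ _ _ _ ⟨x, y, rfl, rfl, h⟩ ⟨x', y', rfl, rfl, h'⟩
      exact ⟨x + x', y + y', map_add .., map_add .., by
        rw [map_add, map_add, mul_add, h, h']⟩)
    (by
      rintro _ _ s ⟨x, y, rfl, rfl, h⟩
      obtain ⟨s, rfl⟩ := hφ.surjective s
      exact ⟨x * s, y * s, map_mul .., map_mul .., by
        rw [map_mul, map_mul, ← mul_assoc, h]⟩)
    (by
      rintro _ _ s ⟨x, y, rfl, rfl, h⟩
      obtain ⟨s, rfl⟩ := hφ.surjective s
      exact ⟨_, s * x, s * y, map_mul .., rfl, by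
        rw [map_mul, map_mul, ← mul_assoc, commute_of_mem_extendedCentroid hq, mul_assoc, h]⟩)
    (by
      intro s hs
      obtain ⟨x, y, h, hx⟩ := hφ.exists_graph_apply_ne_zero q
      refine (hφ.prime s (φ x) fun r => ?_).resolve_right hx
      obtain ⟨r, rfl⟩ := hφ.surjective r
      rw [mul_assoc]
      exact hs _ _ ⟨r * x, r * y, map_mul .., rfl, by
        rw [map_mul, map_mul, ← mul_assoc, commute_of_mem_extendedCentroid hq, mul_assoc, h]⟩)
  exact ⟨c, fun x y h => hc _ _ ⟨x, y, rfl, rfl, h⟩⟩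

theorem ext_of_graph (hφ : IsPrimeFactor φ) {q : MartindaleQuot S} (hq : q ∈ extendedCentroid k S)
    {c c' : MartindaleQuot T}
    (h : ∀ x y, q * of S x = of S y → c * of T (φ x) = c' * of T (φ x)) : c = c' := by
  obtain ⟨x, y, hxy, hx⟩ := hφ.exists_graph_apply_ne_zero q
  have hl : ∀ s, ∀ t ∈ {t | ∃ x y, φ x = t ∧ q * of S x = of S y},
      s * t ∈ {t | ∃ x y, φ x = t ∧ q * of S x = of S y} := by
    rintro s _ ⟨x, y, rfl, hxy⟩
    obtain ⟨s, rfl⟩ := hφ.surjective s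
    exact ⟨s * x, s * y, map_mul .., by
      rw [map_mul, map_mul, ← mul_assoc, commute_of_mem_extendedCentroid hq, mul_assoc, hxy]⟩
  refine ext_of_mul_of hl (hφ.zero_ann hl ⟨x, y, rfl, hxy⟩ hx) ?_
  rintro _ ⟨x, y, rfl, hxy⟩
  exact h x y hxy

/-- The partial map on `T` induced by a central element of the ring of quotients of `S`. -/
noncomputable def descent (hφ : IsPrimeFactor φ) (q : extendedCentroid k S) : MartindaleQuot T :=
  (hφ.exists_descent q.2).choose

theorem descent_mul_of (hφ : IsPrimeFactor φ) (q : extendedCentroid k S) {x y : S}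
    (h : (q : MartindaleQuot S) * of S x = of S y) :
    hφ.descent q * of T (φ x) = of T (φ y) :=
  (hφ.exists_descent q.2).choose_spec x y h

theorem eq_descent (hφ : IsPrimeFactor φ) (q : extendedCentroid k S) {c : MartindaleQuot T}
    (h : ∀ x y, (q : MartindaleQuot S) * of S x = of S y → c * of T (φ x) = of T (φ y)) :
    c = hφ.descent q :=
  hφ.ext_of_graph q.2 fun x y hxy => (h x y hxy).trans (hφ.descent_mul_of q hxy).symm

theorem descent_mem (hφ : IsPrimeFactor φ) (q : extendedCentroid k S) :
    hφ.descent q ∈ extendedCentroid k T := by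
  refine mem_extendedCentroid_of_commute fun t => hφ.ext_of_graph q.2 fun x y hxy => ?_
  obtain ⟨s, rfl⟩ := hφ.surjective t
  have : (q : MartindaleQuot S) * of S (s * x) = of S (s * y) := by
    rw [map_mul, map_mul, ← mul_assoc, commute_of_mem_extendedCentroid q.2, mul_assoc, hxy]
  rw [mul_assoc, ← map_mul, ← map_mul, hφ.descent_mul_of q this, mul_assoc,
    hφ.descent_mul_of q hxy, map_mul, map_mul]

/-- The homomorphism of extended centroids induced by the projection to a prime factor ring. -/
noncomputable def centroidMap (hφ : IsPrimeFactor φ) :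
    extendedCentroid k S →ₐ[k] MartindaleQuot T where
  toFun := hφ.descent
  map_one' := (hφ.eq_descent 1 fun x y h => by
    rw [OneMemClass.coe_one, one_mul] at h
    rw [one_mul, of_injective h]).symm
  map_zero' := (hφ.eq_descent 0 fun x y h => by
    rw [ZeroMemClass.coe_zero, zero_mul, ← map_zero (of S)] at h
    rw [zero_mul, ← of_injective h, map_zero, map_zero]).symm
  map_add' p q := by
    refine hφ.ext_of_graph p.2 fun x y hp => hφ.ext_of_graph q.2 fun x' y' hq => ?_
    have hp' : (p : MartindaleQuot S) * of S (x * x') = of S (y * x') := by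
      rw [map_mul, map_mul, ← mul_assoc, hp]
    have hq' : (q : MartindaleQuot S) * of S (x * x') = of S (x * y') := by
      rw [map_mul, map_mul, ← mul_assoc, commute_of_mem_extendedCentroid q.2, mul_assoc, hq]
    have hpq : ((p + q : extendedCentroid k S) : MartindaleQuot S) * of S (x * x') =
        of S (y * x' + x * y') := by
      rw [map_add, ← hp', ← hq', ← add_mul]; rfl
    rw [mul_assoc, mul_assoc, ← map_mul, ← map_mul, hφ.descent_mul_of _ hpq, add_mul,
      hφ.descent_mul_of _ hp', hφ.descent_mul_of _ hq', ← map_add, ← map_add]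
  map_mul' p q := by
    refine hφ.ext_of_graph p.2 fun x y hp => hφ.ext_of_graph q.2 fun x' y' hq => ?_
    have hq' : (q : MartindaleQuot S) * of S (x * x') = of S (x * y') := by
      rw [map_mul, map_mul, ← mul_assoc, commute_of_mem_extendedCentroid q.2, mul_assoc, hq]
    have hp' : (p : MartindaleQuot S) * of S (x * y') = of S (y * y') := by
      rw [map_mul, map_mul, ← mul_assoc, hp]
    have hpq : ((p * q : extendedCentroid k S) : MartindaleQuot S) * of S (x * x') =
        of S (y * y') := by
      rw [← hp', ← hq', ← mul_assoc]; rfl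
    rw [mul_assoc, mul_assoc, ← map_mul, ← map_mul, hφ.descent_mul_of _ hpq, mul_assoc,
      hφ.descent_mul_of _ hq', hφ.descent_mul_of _ hp']
  commutes' a := (hφ.eq_descent _ fun x y h => by
    have h' : of S (algebraMap k S a * x) = of S y := (map_mul ..).trans h
    rw [← of_injective h', map_mul, map_mul, AlgHom.commutes]
    rfl).symm

theorem centroidMap_mul_of (hφ : IsPrimeFactor φ) (q : extendedCentroid k S) {x y : S}
    (h : (q : MartindaleQuot S) * of S x = of S y) :
    hφ.centroidMap q * of T (φ x) = of T (φ y) :=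
  hφ.descent_mul_of q h

end IsPrimeFactor

end PrimeFactor

/-! ### The identity component -/

/-- In a group with a Noetherian topology for which left translations are continuous, a largest
irreducible set containing `1` exists, and it is a subgroup of finite index. Indeed some point lies
on only one irreducible component, so by homogeneity every point does. -/
theorem exists_finiteIndex_isIrreducible (G : Type*) [Group G] [TopologicalSpace G]
    [TopologicalSpace.NoetherianSpace G] (hG : ∀ g : G, Continuous fun x => g * x) :
    ∃ H : Subgroup G, H.FiniteIndex ∧ IsIrreducible (H : Set G) := by
  have irr (g : G) {W : Set G} (hW : IsIrreducible W) : IsIrreducible ((fun x => g * x) '' W) :=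
    hW.image _ (hG g).continuousOn
  obtain ⟨X, hX, h1, hmax⟩ : ∃ X : Set G, IsIrreducible X ∧ 1 ∈ X ∧
      ∀ W : Set G, IsIrreducible W → 1 ∈ W → W ⊆ X := by
    obtain ⟨o, ho, ⟨x, hx⟩, hoZ⟩ :=
      TopologicalSpace.NoetherianSpace.exists_isOpen_nonempty_subset_irreducibleComponent
        (irreducibleComponent (1 : G)) (irreducibleComponent_mem_irreducibleComponents 1)
    have key : ∀ W : Set G, IsIrreducible W → x ∈ W → W ⊆ irreducibleComponent (1 : G) := by
      intro W hW hxW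
      have := subset_closure_inter_of_isPreirreducible_of_isOpen hW.isPreirreducible ho
        ⟨x, hxW, hx⟩
      exact this.trans (closure_minimal (Set.inter_subset_right.trans hoZ)
        isClosed_irreducibleComponent)
    refine ⟨_, irr x⁻¹ isIrreducible_irreducibleComponent, ⟨x, hoZ hx, by simp⟩, ?_⟩
    intro W hW h1W w hw
    exact ⟨x * w, key _ (irr x hW) ⟨1, h1W, by simp⟩ ⟨w, hw, rfl⟩, by simp⟩
  have hdiv : ∀ {W : Set G}, IsIrreducible W → ∀ g ∈ W, ∀ h ∈ W, g⁻¹ * h ∈ X :=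
    fun {W} hW g hg h hh => hmax _ (irr g⁻¹ hW) ⟨g, hg, by simp⟩ ⟨h, hh, rfl⟩
  have hinv : ∀ g ∈ X, g⁻¹ ∈ X := fun g hg => by simpa using hdiv hX g hg 1 h1
  let H : Subgroup G :=
    { carrier := X
      one_mem' := h1
      mul_mem' := fun {g h} hg hh => by simpa using hdiv hX _ (hinv g hg) h hh
      inv_mem' := fun {g} hg => hinv g hg }
  refine ⟨H, ?_, hX⟩
  have := (TopologicalSpace.NoetherianSpace.finite_irreducibleComponents (α := G)).to_subtype
  have : Finite (G ⧸ H) := by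
    refine Finite.of_injective (fun c : G ⧸ H => (⟨_,
      irreducibleComponent_mem_irreducibleComponents c.out⟩ : irreducibleComponents G)) ?_
    intro c d hcd
    rw [← Quotient.out_eq' c, ← Quotient.out_eq' d]
    refine QuotientGroup.eq.2 (hdiv (isIrreducible_irreducibleComponent (x := c.out)) _
      mem_irreducibleComponent _ ?_)
    rw [Subtype.mk.inj hcd]
    exact mem_irreducibleComponent
  exact Subgroup.finiteIndex_of_finite_quotient

/-! ### The Zariski topology -/

namespace AffineAlgebraicGroup

variable {k G : Type*} [Field k] [Group G] (𝔾 : AffineAlgebraicGroup k G)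

/-- Evaluation of regular functions at a point. -/
def eval (g : G) : 𝔾.regular →ₐ[k] k :=
  (Pi.evalAlgHom k (fun _ : G => k) g).comp 𝔾.regular.val

/-- A point of the group as a point of the prime spectrum of the algebra of regular functions. -/
def toSpec (g : G) : PrimeSpectrum 𝔾.regular :=
  ⟨RingHom.ker (𝔾.eval g), RingHom.ker_isPrime _⟩

/-- The Zariski topology, whose closed sets are the zero loci of sets of regular functions. -/
abbrev zariski : TopologicalSpace G :=
  TopologicalSpace.induced 𝔾.toSpec inferInstance

theorem isClosed_zeroLocus {f : G → k} (hf : f ∈ 𝔾.regular) :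
    @IsClosed G 𝔾.zariski {g | f g = 0} := by
  let _ := 𝔾.zariski
  convert (PrimeSpectrum.isClosed_zeroLocus {(⟨f, hf⟩ : 𝔾.regular)}).preimage
    (continuous_induced_dom (f := 𝔾.toSpec)) using 1
  ext g
  simp only [Set.mem_preimage, PrimeSpectrum.mem_zeroLocus, Set.singleton_subset_iff]
  change f g = 0 ↔ (⟨f, hf⟩ : 𝔾.regular) ∈ RingHom.ker (𝔾.eval g)
  rw [RingHom.mem_ker]
  rfl

theorem noetherianSpace_zariski : @TopologicalSpace.NoetherianSpace G 𝔾.zariski := by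
  let _ := 𝔾.zariski
  have : IsNoetherianRing 𝔾.regular := isNoetherianRing_of_fg 𝔾.fg
  exact Topology.IsInducing.noetherianSpace (i := 𝔾.toSpec) ⟨rfl⟩

theorem comp_mul_left_mem {f : G → k} (hf : f ∈ 𝔾.regular) (g : G) :
    (fun x => f (g * x)) ∈ 𝔾.regular := by
  obtain ⟨n, a, b, -, hb, h⟩ := 𝔾.mul_regular f hf
  have : (fun x => f (g * x)) = ∑ i, a i g • b i := by
    ext x
    simp [h]
  rw [this]
  exact sum_mem fun i _ => Subalgebra.smul_mem _ (hb i) _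

theorem continuous_mul_left_zariski (g : G) :
    @Continuous G G 𝔾.zariski 𝔾.zariski fun x => g * x := by
  let _ := 𝔾.zariski
  -- Translation by `g` on functions is a ring endomorphism, and it induces translation by `g`
  -- on the spectrum.
  let τ : 𝔾.regular →+* 𝔾.regular :=
    { toFun := fun f => ⟨fun x => (f : G → k) (g * x), 𝔾.comp_mul_left_mem f.2 g⟩
      map_one' := rfl
      map_mul' := fun _ _ => rfl
      map_zero' := rfl
      map_add' := fun _ _ => rfl }
  refine continuous_induced_rng.2 ?_
  have : (𝔾.toSpec ∘ fun x => g * x) = PrimeSpectrum.comap τ ∘ 𝔾.toSpec := rfl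
  rw [this]
  exact (PrimeSpectrum.continuous_comap τ).comp continuous_induced_dom

/-- The coefficients of a rational action being regular, so is the condition that `g` moves a
given vector into a given subspace. -/
theorem IsRationalAction.isClosed_smul_mem {𝔾 : AffineAlgebraicGroup k G} {M : Type*}
    [AddCommGroup M] [Module k M] [DistribMulAction G M] [SMulCommClass G k M]
    (h : 𝔾.IsRationalAction M) (W : Submodule k M) (m : M) :
    @IsClosed G 𝔾.zariski {g : G | g • m ∈ W} := by
  let _ := 𝔾.zariski
  let V := Submodule.span k (Set.range fun g : G => g • m)
  have hV : ∀ (g : G) (v : M), v ∈ V → g • v ∈ V := by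
    intro g v hv
    induction hv using Submodule.span_induction with
    | mem x hx =>
      obtain ⟨h, rfl⟩ := hx
      exact Submodule.subset_span ⟨g * h, mul_smul g h m⟩
    | zero => rw [smul_zero]; exact V.zero_mem
    | add x y _ _ hx hy => rw [smul_add]; exact V.add_mem hx hy
    | smul a x _ hx => rw [smul_comm]; exact V.smul_mem a hx
  have hm : m ∈ V := Submodule.subset_span ⟨1, one_smul G m⟩
  have : {g : G | g • m ∈ W} = ⋂ l : {l : M →ₗ[k] k // W ≤ LinearMap.ker l},
      {g : G | (l : M →ₗ[k] k) (g • m) = 0} := by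
    ext g
    simp only [Set.mem_ofPred_eq, Set.mem_iInter]
    refine ⟨fun hg l => l.2 hg, fun hg => ?_⟩
    by_contra hW
    obtain ⟨l, hl, hWl⟩ := Submodule.exists_le_ker_of_notMem hW
    exact hl (hg ⟨l, hWl⟩)
  rw [this]
  exact isClosed_iInter fun l => 𝔾.isClosed_zeroLocus
    (h.regular_coeff V (h.locallyFinite m) hV ⟨m, hm⟩ ((l : M →ₗ[k] k).comp V.subtype))

end AffineAlgebraicGroup

/-! ### Cores of ideals -/

section Core

variable {G R : Type*} [Group G] [Ring R] [MulSemiringAction G R]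

/-- The ideal of all `x` that every element of a given set `X ⊆ G` moves into the ideal `Q`. For a
subgroup `X` this is the `X`-core `⋂_{g ∈ X} g.Q`. -/
def coreOn (X : Set G) (Q : TwoSidedIdeal R) : TwoSidedIdeal R :=
  TwoSidedIdeal.mk' {x | ∀ g ∈ X, g • x ∈ Q}
    (fun g _ => by simp)
    (fun hx hy g hg => by rw [smul_add]; exact Q.add_mem (hx g hg) (hy g hg))
    (fun hx g hg => by rw [smul_neg]; exact Q.neg_mem (hx g hg))
    (fun hy g hg => by rw [smul_mul']; exact Q.mul_mem_left _ _ (hy g hg))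
    (fun hx g hg => by rw [smul_mul']; exact Q.mul_mem_right _ _ (hx g hg))

theorem mem_coreOn {X : Set G} {Q : TwoSidedIdeal R} {x : R} :
    x ∈ coreOn X Q ↔ ∀ g ∈ X, g • x ∈ Q :=
  TwoSidedIdeal.mem_mk' ..

theorem mem_gCore {Q : TwoSidedIdeal R} {x : R} : x ∈ gCore G Q ↔ ∀ g : G, g • x ∈ Q := by
  simp only [gCore, Set.mem_iInter, Set.mem_smul_set_iff_inv_smul_mem, SetLike.mem_coe]
  exact ⟨fun h g => by simpa using h g⁻¹, fun h g => h g⁻¹⟩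

theorem isGStable_of_smul_mem {I : TwoSidedIdeal R} (h : ∀ (g : G), ∀ x ∈ I, g • x ∈ I) :
    IsGStable G I := fun g => by
  ext x
  rw [Set.mem_smul_set_iff_inv_smul_mem]
  exact ⟨fun hx => by simpa using h g _ hx, h g⁻¹ x⟩

theorem IsGStable.smul_mem {I : TwoSidedIdeal R} (h : IsGStable G I) (g : G) {x : R}
    (hx : x ∈ I) : g • x ∈ I := by
  rw [← SetLike.mem_coe, ← h g]
  exact Set.smul_mem_smul_set hx

theorem mem_isotropyGroup_iff {Q : TwoSidedIdeal R} {g : G} :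
    g ∈ isotropyGroup G Q ↔ ∀ x, g • x ∈ Q ↔ x ∈ Q := by
  rw [MulAction.mem_stabilizer_iff]
  refine ⟨fun h x => ?_, fun h => ?_⟩
  · rw [← SetLike.mem_coe, ← SetLike.mem_coe]
    nth_rewrite 1 [← h]
    exact Set.smul_mem_smul_set_iff
  · ext x
    rw [Set.mem_smul_set_iff_inv_smul_mem, SetLike.mem_coe, ← h, smul_inv_smul, SetLike.mem_coe]

theorem isGStable_coreOn_univ (Q : TwoSidedIdeal R) : IsGStable G (coreOn (Set.univ : Set G) Q) :=
  isGStable_of_smul_mem fun g x hx => mem_coreOn.2 fun h _ => by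
    rw [smul_smul]; exact mem_coreOn.1 hx _ trivial

/-- The core of a prime ideal `Q` over a set that is irreducible in the Zariski topology is prime.
If `a R b` lies in the core, then the set is covered by two closed sets, one consisting of all `g`
with `g.a ∈ Q` and one of all `g` with `g.b ∈ Q`. -/
theorem IsPrimeTwoSided.isPrimeTwoSided_coreOn {k : Type*} [Field k] [Algebra k R] [SMulCommClass G k R]
    {𝔾 : AffineAlgebraicGroup k G} (hrat : 𝔾.IsRationalAction R) {Q : TwoSidedIdeal R}
    (hQ : IsPrimeTwoSided Q) {X : Set G} (h1 : 1 ∈ X)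
    (hX : @IsPreirreducible G 𝔾.zariski X) : IsPrimeTwoSided (coreOn X Q) := by
  let _ := 𝔾.zariski
  refine isPrimeTwoSided_of_forall_mul (fun h => hQ.ne_top (top_le_iff.1 fun x _ => ?_)) ?_
  · have := mem_coreOn.1 (h ▸ TwoSidedIdeal.mem_top R : x ∈ coreOn X Q) 1 h1
    rwa [one_smul] at this
  intro a b hab
  have hcl (c : R) : IsClosed {g : G | g • c ∈ Q} :=
    hrat.isClosed_smul_mem ((TwoSidedIdeal.asIdeal Q).restrictScalars k) c
  have hcov : X ⊆ {g : G | g • a ∈ Q} ∪ {g : G | g • b ∈ Q} := fun g hg =>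
    hQ.mem_or_mem_of_forall_mul fun r => by
      have := mem_coreOn.1 (hab (g⁻¹ • r)) g hg
      rwa [smul_mul', smul_mul', smul_inv_smul] at this
  exact (isPreirreducible_iff_isClosed_union_isClosed.1 hX _ _ (hcl a) (hcl b) hcov).imp
    (fun h => mem_coreOn.2 h) fun h => mem_coreOn.2 h

/-- Each `G`-prime ideal is the `G`-core of a prime ideal, namely of any ideal that is maximal among
those whose core is contained in it. Local finiteness of the action makes Zorn's lemma
applicable. -/
theorem IsGPrime.exists_isPrimeTwoSided {k : Type*} [Field k] [Algebra k R] [SMulCommClass G k R]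
    (hfin : ∀ x : R, FiniteDimensional k (Submodule.span k (Set.range fun g : G => g • x)))
    {I : TwoSidedIdeal R} (hI : IsGPrime G I) :
    ∃ Q : TwoSidedIdeal R, IsPrimeTwoSided Q ∧ ∀ x, x ∈ I ↔ ∀ g : G, g • x ∈ Q := by
  obtain ⟨Q, hIQ, hQ, hmax⟩ := zorn_le_nonempty₀
    {Q : TwoSidedIdeal R | coreOn (Set.univ : Set G) Q ≤ I} (by
      intro c hc hchain P hP
      let U : TwoSidedIdeal R := TwoSidedIdeal.mk' {x | ∃ A ∈ c, x ∈ A} ⟨P, hP, P.zero_mem⟩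
        (by
          rintro x y ⟨A, hA, hx⟩ ⟨B, hB, hy⟩
          rcases hchain.total hA hB with h | h
          · exact ⟨B, hB, B.add_mem (h hx) hy⟩
          · exact ⟨A, hA, A.add_mem hx (h hy)⟩)
        (fun ⟨A, hA, hx⟩ => ⟨A, hA, A.neg_mem hx⟩)
        (fun ⟨A, hA, hx⟩ => ⟨A, hA, A.mul_mem_left _ _ hx⟩)
        (fun ⟨A, hA, hx⟩ => ⟨A, hA, A.mul_mem_right _ _ hx⟩)
      have hU (x : R) : x ∈ U ↔ ∃ A ∈ c, x ∈ A := TwoSidedIdeal.mem_mk' ..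
      refine ⟨U, fun x hx => ?_, fun A hA x hx => (hU x).2 ⟨A, hA, hx⟩⟩
      -- The span of the orbit of `x` is finite-dimensional and lies in the union of the chain,
      -- hence in a member of the chain.
      obtain ⟨t, ht⟩ := Module.Finite.iff_fg.1 (hfin x)
      have htU : ∀ y ∈ t, y ∈ U := fun y hy => by
        have hle : Submodule.span k (Set.range fun g : G => g • x) ≤
            (TwoSidedIdeal.asIdeal U).restrictScalars k :=
          Submodule.span_le.2 (by rintro _ ⟨g, rfl⟩; exact mem_coreOn.1 hx g trivial)
        exact hle (ht ▸ Submodule.subset_span hy)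
      obtain ⟨A, hA, htA⟩ : ∃ A ∈ c, ∀ y ∈ t, y ∈ A := by
        clear ht
        classical
        induction t using Finset.induction_on with
        | empty => exact ⟨P, hP, by simp⟩
        | insert y t _ ih =>
          obtain ⟨A, hA, h⟩ := ih fun z hz => htU z (Finset.mem_insert_of_mem hz)
          obtain ⟨B, hB, hy⟩ := (hU y).1 (htU y (Finset.mem_insert_self ..))
          rcases hchain.total hA hB with hAB | hAB
          · exact ⟨B, hB, (Finset.forall_mem_insert ..).2 ⟨hy, fun z hz => hAB (h z hz)⟩⟩
          · exact ⟨A, hA, (Finset.forall_mem_insert ..).2 ⟨hAB hy, h⟩⟩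
      refine hc hA (mem_coreOn.2 fun g _ => ?_)
      have hle : Submodule.span k (t : Set R) ≤ (TwoSidedIdeal.asIdeal A).restrictScalars k :=
        Submodule.span_le.2 htA
      rw [ht] at hle
      exact hle (Submodule.subset_span ⟨g, rfl⟩))
    I (fun x hx => by simpa using mem_coreOn.1 hx 1 trivial)
  refine ⟨Q, isPrimeTwoSided_of_forall_mul ?_ fun a b hab => ?_, fun x =>
    ⟨fun hx g => hIQ (hI.stable.smul_mem g hx), fun h => hQ (mem_coreOn.2 fun g _ => h g)⟩⟩
  · rintro rfl
    exact hI.ne_top (top_le_iff.1 fun x _ => hQ (mem_coreOn.2 fun _ _ => TwoSidedIdeal.mem_top R))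
  · obtain ⟨A, B, hA, hB, ha, hb, hAB⟩ := TwoSidedIdeal.exists_mul_le_of_forall_mul hab
    refine (hI.mem_or_mem _ _ (isGStable_coreOn_univ A) (isGStable_coreOn_univ B)
      fun x hx y hy => hQ (mem_coreOn.2 fun g _ => ?_)).imp
      (fun h => hmax h hA ha) (fun h => hmax h hB hb)
    rw [smul_mul']
    exact hAB _ (mem_coreOn.1 hx g trivial) _ (mem_coreOn.1 hy g trivial)

theorem IsGPrime.exists_isPrimeTwoSided_finiteIndex {k : Type*} [Field k] [Algebra k R]
    [SMulCommClass G k R] {𝔾 : AffineAlgebraicGroup k G} (hrat : 𝔾.IsRationalAction R)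
    {I : TwoSidedIdeal R} (hI : IsGPrime G I) :
    ∃ Q : TwoSidedIdeal R, IsPrimeTwoSided Q ∧ (isotropyGroup G Q).FiniteIndex ∧
      (I : Set R) = gCore G Q := by
  let _ := 𝔾.zariski
  have := 𝔾.noetherianSpace_zariski
  obtain ⟨H, hH, hirr⟩ := exists_finiteIndex_isIrreducible G 𝔾.continuous_mul_left_zariski
  obtain ⟨Q, hQ, hIQ⟩ := hI.exists_isPrimeTwoSided hrat.locallyFinite
  refine ⟨coreOn (H : Set G) Q, hQ.isPrimeTwoSided_coreOn hrat H.one_mem hirr.isPreirreducible, ?_, ?_⟩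
  · refine Subgroup.finiteIndex_of_le (H := H) fun g hg => mem_isotropyGroup_iff.2 fun x => ?_
    simp only [mem_coreOn, smul_smul]
    exact ⟨fun h a ha => by simpa using h (a * g⁻¹) (H.mul_mem ha (H.inv_mem hg)),
      fun h a ha => h _ (H.mul_mem ha hg)⟩
  · ext x
    simp only [mem_gCore, SetLike.mem_coe, hIQ, mem_coreOn, smul_smul]
    exact ⟨fun h g a _ => h _, fun h g => by simpa using h g 1 H.one_mem⟩

end Core

/-! ### Conjugates of a prime ideal with finite orbit -/

section Conjugates

variable {G R : Type*} [Group G] [Ring R] [MulSemiringAction G R]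

/-- The intersection of the conjugates of `Q` other than `Q` itself is not contained in `Q`, since
no two of the finitely many conjugates are comparable. -/
theorem IsPrimeTwoSided.exists_mem_coreOn_compl {Q : TwoSidedIdeal R} (hQ : IsPrimeTwoSided Q)
    (hfin : (isotropyGroup G Q).FiniteIndex) :
    ∃ n ∈ coreOn ((isotropyGroup G Q : Set G)ᶜ) Q, n ∉ Q := by
  classical
  let c (g : G) : TwoSidedIdeal R := coreOn {g} Q
  have hc (g : G) (x : R) : x ∈ c g ↔ g • x ∈ Q := by simp [c, mem_coreOn]
  have hcoset (g h : G) (hgh : g * h⁻¹ ∈ isotropyGroup G Q) : c g = c h := by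
    refine TwoSidedIdeal.ext fun x => ?_
    rw [hc, hc, ← mem_isotropyGroup_iff.1 hgh (h • x), smul_smul, inv_mul_cancel_right]
  have hrange : (c '' ((isotropyGroup G Q : Set G)ᶜ)).Finite := by
    refine Set.Finite.subset (Set.finite_range fun a : G ⧸ isotropyGroup G Q => c a.out⁻¹) ?_
    rintro _ ⟨g, -, rfl⟩
    refine ⟨(g⁻¹ : G), hcoset _ _ ?_⟩
    exact QuotientGroup.eq.1 (QuotientGroup.out_eq' ((g⁻¹ : G) : G ⧸ isotropyGroup G Q))
  by_contra! h
  obtain ⟨A, hA, hle⟩ := hQ.exists_le_of_finset_inf_le hrange.toFinset fun x hx => by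
    refine h x (mem_coreOn.2 fun g hg => (hc g x).1 ?_)
    exact Finset.inf_le (f := id) (hrange.mem_toFinset.2 ⟨g, hg, rfl⟩) hx
  obtain ⟨g, hg, rfl⟩ := hrange.mem_toFinset.1 hA
  -- Some positive power of `g` fixes `Q`, so `g⁻¹.Q ⊆ Q` forces equality.
  have hg1 : ∀ x, g • x ∈ Q → x ∈ Q := fun x hx => hle ((hc g x).2 hx)
  have hgn : ∀ (n : ℕ) (x : R), g ^ n • x ∈ Q → x ∈ Q := by
    intro n
    induction n with
    | zero => intro x hx; simpa using hx
    | succ n ih => intro x hx; exact hg1 x (ih _ (by rwa [smul_smul, ← pow_succ]))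
  obtain ⟨n, hn0, -, hn⟩ := Subgroup.exists_pow_mem_of_index_ne_zero hfin.index_ne_zero g
  refine hg (mem_isotropyGroup_iff.2 fun x => ⟨hg1 x, fun hx => hgn (n - 1) _ ?_⟩)
  rw [smul_smul, ← pow_succ, Nat.sub_add_cancel hn0]
  exact (mem_isotropyGroup_iff.1 hn x).2 hx

end Conjugates

/-! ### Comparison of the invariants -/

section Comparison

open MartindaleQuot

/-- The projection `R → R / I`. -/
abbrev quotMk (k : Type*) {R : Type*} [Field k] [Ring R] [Algebra k R] (I : TwoSidedIdeal R) :
    R →ₐ[k] quotAlg I :=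
  RingCon.mkₐ k I.ringCon

variable {k G R : Type*} [Field k] [Group G] [Ring R] [Algebra k R]
  [MulSemiringAction G R]

theorem quotMk_surjective (I : TwoSidedIdeal R) : Function.Surjective (quotMk k I) :=
  Quotient.mk_surjective

theorem quotMk_eq_zero {I : TwoSidedIdeal R} {x : R} : quotMk k I x = 0 ↔ x ∈ I :=
  (RingCon.eq I.ringCon).trans (TwoSidedIdeal.mem_iff I x).symm

theorem quotAut_quotMk [SMulCommClass G k R] (I : TwoSidedIdeal R) (g : G) (hg : g ∈ isotropyGroup G I) (x : R) :
    quotAut k I g hg (quotMk k I x) = quotMk k I (g • x) :=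
  rfl

theorem isPrimeFactor_factor {I Q : TwoSidedIdeal R} (hQ : IsPrimeTwoSided Q)
    (hfin : (isotropyGroup G Q).FiniteIndex) (hIQ : ∀ x, x ∈ I ↔ ∀ g : G, g • x ∈ Q)
    (hle : I.ringCon ≤ Q.ringCon) : IsPrimeFactor (RingCon.factorₐ k hle) where
  surjective t := by
    obtain ⟨x, rfl⟩ := quotMk_surjective (k := k) Q t
    exact ⟨quotMk k I x, rfl⟩
  prime a b h := by
    obtain ⟨a, rfl⟩ := quotMk_surjective (k := k) Q a
    obtain ⟨b, rfl⟩ := quotMk_surjective (k := k) Q b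
    rw [quotMk_eq_zero, quotMk_eq_zero]
    refine hQ.mem_or_mem_of_forall_mul fun r => quotMk_eq_zero (k := k).1 ?_
    rw [map_mul, map_mul]
    exact h _
  exists_ideal := by
    obtain ⟨n, hn, hnQ⟩ := hQ.exists_mem_coreOn_compl hfin
    let N := coreOn ((isotropyGroup G Q : Set G)ᶜ) Q
    let N' : TwoSidedIdeal (quotAlg I) := TwoSidedIdeal.mk' {s | ∃ x ∈ N, quotMk k I x = s}
      ⟨0, N.zero_mem, map_zero _⟩
      (by rintro _ _ ⟨x, hx, rfl⟩ ⟨y, hy, rfl⟩; exact ⟨x + y, N.add_mem hx hy, map_add ..⟩)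
      (by rintro _ ⟨x, hx, rfl⟩; exact ⟨-x, N.neg_mem hx, map_neg ..⟩)
      (by
        rintro s _ ⟨x, hx, rfl⟩
        obtain ⟨s, rfl⟩ := quotMk_surjective (k := k) I s
        exact ⟨s * x, N.mul_mem_left _ _ hx, map_mul ..⟩)
      (by
        rintro _ s ⟨x, hx, rfl⟩
        obtain ⟨s, rfl⟩ := quotMk_surjective (k := k) I s
        exact ⟨x * s, N.mul_mem_right _ _ hx, map_mul ..⟩)
    have hN' (s : quotAlg I) : s ∈ N' ↔ ∃ x ∈ N, quotMk k I x = s := TwoSidedIdeal.mem_mk' ..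
    refine ⟨N', fun s hs h0 => ?_, quotMk k I n, (hN' _).2 ⟨n, hn, rfl⟩,
      fun h => hnQ (quotMk_eq_zero (k := k).1 h)⟩
    obtain ⟨x, hx, rfl⟩ := (hN' s).1 hs
    have hxQ : x ∈ Q := quotMk_eq_zero (k := k).1 h0
    refine quotMk_eq_zero.2 ((hIQ x).2 fun g => ?_)
    by_cases hg : g ∈ isotropyGroup G Q
    · exact (mem_isotropyGroup_iff.1 hg x).2 hxQ
    · exact mem_coreOn.1 hx g hg

variable [SMulCommClass G k R]

theorem extend_mul_of_smul {I : TwoSidedIdeal R} {g : G} (hg : g ∈ isotropyGroup G I)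
    {q : MartindaleQuot (quotAlg I)} {x y : R}
    (h : q * of _ (quotMk k I x) = of _ (quotMk k I y)) :
    extend (quotAut k I g hg) q * of _ (quotMk k I (g • x)) = of _ (quotMk k I (g • y)) := by
  have := congrArg (extend (quotAut k I g hg)) h
  rwa [map_mul, extend_of, extend_of, quotAut_quotMk, quotAut_quotMk] at this

theorem mul_of_smul_of_mem {I : TwoSidedIdeal R} {H : Subgroup G} {hH : H ≤ isotropyGroup G I}
    {q : MartindaleQuot (quotAlg I)} (hq : q ∈ invExtendedCentroid k I H hH) {g : G} (hg : g ∈ H)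
    {x y : R} (h : q * of _ (quotMk k I x) = of _ (quotMk k I y)) :
    q * of _ (quotMk k I (g • x)) = of _ (quotMk k I (g • y)) := by
  have := extend_mul_of_smul (hH hg) h
  rwa [hq.2 g hg] at this

variable {I Q : TwoSidedIdeal R} {hle : I.ringCon ≤ Q.ringCon}

theorem centroidMap_mem_inv (hφ : IsPrimeFactor (RingCon.factorₐ k hle)) (hI : IsGStable G I)
    {q : MartindaleQuot (quotAlg I)}
    (hq : q ∈ invExtendedCentroid k I (⊤ : Subgroup G) fun g _ => hI g) :
    hφ.centroidMap ⟨q, hq.1⟩ ∈ invExtendedCentroid k Q (isotropyGroup G Q) le_rfl := by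
  refine ⟨hφ.descent_mem ⟨q, hq.1⟩, fun g hg => hφ.eq_descent ⟨q, hq.1⟩ fun s t hst => ?_⟩
  obtain ⟨x, rfl⟩ := quotMk_surjective (k := k) I s
  obtain ⟨y, rfl⟩ := quotMk_surjective (k := k) I t
  have h1 := mul_of_smul_of_mem hq (Subgroup.mem_top g⁻¹) hst
  have h2 : hφ.centroidMap ⟨q, hq.1⟩ * of _ (quotMk k Q (g⁻¹ • x)) =
    of _ (quotMk k Q (g⁻¹ • y)) := hφ.centroidMap_mul_of ⟨q, hq.1⟩ h1
  have h3 := extend_mul_of_smul hg h2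
  rwa [smul_inv_smul, smul_inv_smul] at h3

/-- An invariant partial map on `R / I` whose reduction modulo `Q` vanishes takes values in the
intersection of all conjugates of `Q`, which is `I`. -/
theorem eq_zero_of_centroidMap_eq_zero (hφ : IsPrimeFactor (RingCon.factorₐ k hle))
    (hI : IsGStable G I) (hIQ : ∀ x, x ∈ I ↔ ∀ g : G, g • x ∈ Q)
    {q : MartindaleQuot (quotAlg I)}
    (hq : q ∈ invExtendedCentroid k I (⊤ : Subgroup G) fun g _ => hI g)
    (h0 : hφ.centroidMap ⟨q, hq.1⟩ = 0) : q = 0 := by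
  obtain ⟨J, hJ, hdom⟩ := exists_dom q
  refine ext_of_mul_of_ideal hJ fun s hs => ?_
  obtain ⟨t, hst⟩ := hdom s hs
  obtain ⟨x, rfl⟩ := quotMk_surjective (k := k) I s
  obtain ⟨y, rfl⟩ := quotMk_surjective (k := k) I t
  rw [zero_mul, hst, quotMk_eq_zero.2, map_zero]
  refine (hIQ y).2 fun g => ?_
  have h1 := hφ.centroidMap_mul_of ⟨q, hq.1⟩ (mul_of_smul_of_mem hq (Subgroup.mem_top g) hst)
  rw [h0, zero_mul] at h1
  exact quotMk_eq_zero (k := k).1 (of_injective (h1.symm.trans (map_zero _).symm))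

/-- Every invariant `c` of the extended centroid of `R / Q` lifts to `R / I`: the lift sends `x` to
`y` if `c` sends `g.x` to `g.y` modulo `Q` for all `g ∈ G`. The domain of this map is not contained
in `Q`, because it contains `x n` for all `x` in the domain of `c` and all `n` in the intersection
of the conjugates of `Q` other than `Q`. -/
theorem exists_centroidMap_eq (hφ : IsPrimeFactor (RingCon.factorₐ k hle)) (hI : IsGStable G I)
    (hQ : IsPrimeTwoSided Q) (hfin : (isotropyGroup G Q).FiniteIndex)
    (hIQ : ∀ x, x ∈ I ↔ ∀ g : G, g • x ∈ Q) {c : MartindaleQuot (quotAlg Q)}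
    (hc : c ∈ invExtendedCentroid k Q (isotropyGroup G Q) le_rfl) :
    ∃ (q : MartindaleQuot (quotAlg I))
      (hq : q ∈ invExtendedCentroid k I (⊤ : Subgroup G) fun g _ => hI g),
      hφ.centroidMap ⟨q, hq.1⟩ = c := by
  let r (x y : R) : Prop :=
    ∀ g : G, c * of _ (quotMk k Q (g • x)) = of _ (quotMk k Q (g • y))
  have r_smul {x y : R} (h : r x y) (g : G) : r (g • x) (g • y) := fun a => by
    rw [smul_smul, smul_smul]; exact h _
  have r_left {x y : R} (h : r x y) (s : R) : r (s * x) (s * y) := fun g => by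
    rw [smul_mul', smul_mul', map_mul, map_mul, map_mul, map_mul, ← mul_assoc,
      commute_of_mem_extendedCentroid hc.1, mul_assoc, h]
  have r_right {x y : R} (h : r x y) (s : R) : r (x * s) (y * s) := fun g => by
    rw [smul_mul', smul_mul', map_mul, map_mul, map_mul, map_mul, ← mul_assoc, h]
  -- An element of the domain of the lift outside `Q`.
  obtain ⟨z, w, hzw, hz⟩ : ∃ z w, r z w ∧ z ∉ Q := by
    obtain ⟨n, hn, hnQ⟩ := hQ.exists_mem_coreOn_compl hfin
    obtain ⟨J, hJ, hdom⟩ := exists_dom c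
    obtain ⟨s, hs, hs0⟩ : ∃ s ∈ J, s ≠ 0 := by
      by_contra! h
      refine hQ.ne_top (top_le_iff.1 fun x _ => quotMk_eq_zero (k := k).1 ?_)
      exact hJ _ fun s hs => by rw [h s hs, mul_zero]
    obtain ⟨t, hst⟩ := hdom s hs
    obtain ⟨x, rfl⟩ := quotMk_surjective (k := k) Q s
    obtain ⟨y, rfl⟩ := quotMk_surjective (k := k) Q t
    obtain ⟨a, ha⟩ : ∃ a, x * a * n ∉ Q := by
      by_contra! h
      exact (hQ.mem_or_mem_of_forall_mul h).elim (fun h => hs0 (quotMk_eq_zero.2 h)) hnQ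
    refine ⟨x * a * n, y * a * n, fun g => ?_, ha⟩
    by_cases hg : g ∈ isotropyGroup G Q
    · refine mul_of_smul_of_mem hc hg ?_
      rw [mul_assoc, mul_assoc, map_mul _ x, map_mul _ y, map_mul (of _) (quotMk k Q x),
        map_mul (of _) (quotMk k Q y), ← mul_assoc, hst]
    · have hgn (b : R) : quotMk k Q (g • (b * n)) = 0 := by
        rw [quotMk_eq_zero, smul_mul']
        exact Q.mul_mem_left _ _ (mem_coreOn.1 hn g hg)
      rw [hgn, hgn, map_zero, mul_zero]
  have hann (s : quotAlg I) (hs : ∀ x y, r x y → s * quotMk k I x = 0) : s = 0 := by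
    obtain ⟨s, rfl⟩ := quotMk_surjective (k := k) I s
    refine quotMk_eq_zero.2 ((hIQ s).2 fun g => ?_)
    refine (hQ.mem_or_mem_of_forall_mul fun a => ?_).resolve_right hz
    have h1 := hs _ _ (r_smul (r_left hzw a) g⁻¹)
    rw [← map_mul, quotMk_eq_zero] at h1
    have h2 := (hIQ _).1 h1 g
    rwa [smul_mul', smul_inv_smul, ← mul_assoc] at h2
  obtain ⟨q, hq⟩ := exists_of_graph
    (fun s t : quotAlg I => ∃ x y, quotMk k I x = s ∧ quotMk k I y = t ∧ r x y)
    ⟨0, 0, map_zero _, map_zero _, fun g => by simp⟩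
    (by
      rintro _ ⟨x, y, hx, rfl, h⟩
      rw [quotMk_eq_zero, hIQ] at hx
      refine quotMk_eq_zero.2 ((hIQ y).2 fun g => quotMk_eq_zero (k := k).1 (of_injective ?_))
      rw [← h g, quotMk_eq_zero.2 (hx g), map_zero, mul_zero])
    (by
      rintro _ _ _ _ ⟨x, y, rfl, rfl, h⟩ ⟨x', y', rfl, rfl, h'⟩
      exact ⟨x + x', y + y', map_add .., map_add .., fun g => by
        rw [smul_add, smul_add, map_add, map_add, map_add, map_add, mul_add, h, h']⟩)
    (by
      rintro _ _ s ⟨x, y, rfl, rfl, h⟩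
      obtain ⟨s, rfl⟩ := quotMk_surjective (k := k) I s
      exact ⟨x * s, y * s, map_mul .., map_mul .., r_right h s⟩)
    (by
      rintro _ _ s ⟨x, y, rfl, rfl, h⟩
      obtain ⟨s, rfl⟩ := quotMk_surjective (k := k) I s
      exact ⟨_, s * x, s * y, map_mul .., rfl, r_left h s⟩)
    (fun s hs => hann s fun x y h => hs _ _ ⟨x, y, rfl, rfl, h⟩)
  replace hq {x y : R} (h : r x y) : q * of _ (quotMk k I x) = of _ (quotMk k I y) :=
    hq _ _ ⟨x, y, rfl, rfl, h⟩
  have ext_r {p p' : MartindaleQuot (quotAlg I)}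
      (h : ∀ x y, r x y → p * of _ (quotMk k I x) = p' * of _ (quotMk k I x)) : p = p' := by
    refine ext_of_mul_of (D := {s | ∃ x y, quotMk k I x = s ∧ r x y}) ?_
      (fun s hs => hann s fun x y h => hs _ ⟨x, y, rfl, h⟩) ?_
    · rintro s _ ⟨x, y, rfl, h⟩
      obtain ⟨s, rfl⟩ := quotMk_surjective (k := k) I s
      exact ⟨s * x, s * y, map_mul .., r_left h s⟩
    · rintro _ ⟨x, y, rfl, hxy⟩
      exact h x y hxy
  have hqC : q ∈ extendedCentroid k (quotAlg I) := by
    refine mem_extendedCentroid_of_commute fun s => ext_r fun x y h => ?_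
    obtain ⟨s, rfl⟩ := quotMk_surjective (k := k) I s
    rw [mul_assoc, ← map_mul, ← map_mul, hq (r_left h s), mul_assoc, hq h, map_mul, map_mul]
  have hqI : q ∈ invExtendedCentroid k I (⊤ : Subgroup G) fun g _ => hI g := by
    refine ⟨hqC, fun g hg => ext_r fun x y h => ?_⟩
    have := extend_mul_of_smul (hI g) (hq (r_smul h g⁻¹))
    rw [smul_inv_smul, smul_inv_smul] at this
    rw [hq h]
    exact this
  refine ⟨q, hqI, ?_⟩
  -- The reduction of the lift and `c` agree on the image of the domain of the lift.
  refine ext_of_mul_of (D := {s | ∃ x y, quotMk k Q x = s ∧ r x y}) (fun s t ht => ?_) ?_ ?_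
  · obtain ⟨x, y, rfl, h⟩ := ht
    obtain ⟨s, rfl⟩ := quotMk_surjective (k := k) Q s
    exact ⟨s * x, s * y, map_mul .., r_left h s⟩
  · intro s hs
    refine (hφ.prime s (quotMk k Q z) fun t => ?_).resolve_right fun h => hz (quotMk_eq_zero.1 h)
    obtain ⟨t, rfl⟩ := quotMk_surjective (k := k) Q t
    rw [mul_assoc, ← map_mul]
    exact hs _ ⟨t * z, t * w, rfl, r_left hzw t⟩
  · rintro _ ⟨x, y, rfl, h⟩
    have h1 := h 1
    rw [one_smul, one_smul] at h1
    exact (hφ.centroidMap_mul_of ⟨q, hqC⟩ (hq h)).trans h1.symm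

end Comparison

theorem mainTheorem6 {k G R : Type*} [Field k] [IsAlgClosed k] [Group G]
    (𝔾 : AffineAlgebraicGroup k G) [Ring R] [Algebra k R] [MulSemiringAction G R]
    [SMulCommClass G k R] (hrat : 𝔾.IsRationalAction R)
    (I : TwoSidedIdeal R) (hI : IsGPrime G I) :
    (∃ Q : TwoSidedIdeal R, IsPrimeTwoSided Q ∧ (isotropyGroup G Q).FiniteIndex ∧
      (I : Set R) = gCore G Q) ∧
    ∀ Q : TwoSidedIdeal R, IsPrimeTwoSided Q → (isotropyGroup G Q).FiniteIndex →
      (I : Set R) = gCore G Q →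
      Nonempty (invExtendedCentroid k I (⊤ : Subgroup G) (fun g _ => hI.stable g) ≃ₐ[k]
        invExtendedCentroid k Q (isotropyGroup G Q) le_rfl) := by
  refine ⟨hI.exists_isPrimeTwoSided_finiteIndex hrat, fun Q hQ hfin hIQ' => ?_⟩
  have hIQ (x : R) : x ∈ I ↔ ∀ g : G, g • x ∈ Q := by
    rw [← SetLike.mem_coe, hIQ', mem_gCore]
  have hle : I.ringCon ≤ Q.ringCon := TwoSidedIdeal.ringCon_le_iff.1 fun x hx => by
    simpa using (hIQ x).1 hx 1
  have hφ := isPrimeFactor_factor (k := k) hQ hfin hIQ hle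
  have inv_le : invExtendedCentroid k I (⊤ : Subgroup G) (fun g _ => hI.stable g) ≤
      extendedCentroid k (quotAlg I) := fun q hq => And.left hq
  let Φ : invExtendedCentroid k I (⊤ : Subgroup G) (fun g _ => hI.stable g) →ₐ[k]
      invExtendedCentroid k Q (isotropyGroup G Q) le_rfl :=
    (hφ.centroidMap.comp (Subalgebra.inclusion inv_le)).codRestrict _
      fun q => centroidMap_mem_inv hφ hI.stable q.2
  refine ⟨AlgEquiv.ofBijective Φ ⟨(injective_iff_map_eq_zero Φ).2 fun q h => ?_, fun c => ?_⟩⟩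
  · exact Subtype.ext (eq_zero_of_centroidMap_eq_zero hφ hI.stable hIQ q.2
      (congrArg Subtype.val h))
  · obtain ⟨q, hq, h⟩ := exists_centroidMap_eq hφ hI.stable hQ hfin hIQ c.2
    exact ⟨⟨q, hq⟩, Subtype.ext h⟩
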